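/- All graphs are finite and simple and $\log$ is the logarithm to base $2$. For integers $t\ge 2$ and $n\ge 0$ let $Q(t,n)$ be the minimum independence number of a $K_t$-free graph on $n$ vertices, and for real $x\ge 0$ put $Q(t,x)=Q(t,\lfloor x\rfloor)$. For a graph $H$ let $RT(n,H,m)$ be the maximum number of edges of an $H$-free graph on $n$ vertices with independence number less than $m$ (and $0$ if there is no such graph), and for a function $g$ let $RT^*(H,g(n))=\limsup_{n\to\infty} RT(n,H,g(n))/n^2$. Theorem. Let $p,q,t\ge 2$ be integers, let $\omega(n)$ be any real-valued function with $\omega(n)\to\infty$ as $n\to\infty$, and let $f(n)=n\,2^{-\omega(n)\,(\log n)^{1-1/q}}$. Suppose that $2t\le pq$ and that $Q\left(t,\frac{n}{\omega(n)}\right)\le Q(p,f(n))$ for all sufficiently large $n$. Then $$RT^*\left(K_{2t},\,Q\left(t,\tfrac{n}{\omega(n)}\right)\right)\le \frac12\left(1-\frac1t\right)\left(1-\frac1{q-1}\right).$$ -/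

import Mathlib

open Filter

/-- `ramseyQ t n` is the minimum independence number of a `K_t`-free graph on `n` vertices
(such graphs exist whenever `2 ≤ t`). -/
noncomputable def ramseyQ (t n : ℕ) : ℕ :=
  sInf {a : ℕ | ∃ G : SimpleGraph (Fin n), G.CliqueFree t ∧ G.indepNum = a}

/-- The Ramsey-Turán number `RT(n, H, m)`: the maximum number of edges of an `H`-free graph on
`n` vertices whose independence number is less than `m` (and `0` if there is no such graph). -/
noncomputable def ramseyTuran {W : Type*} (n : ℕ) (H : SimpleGraph W) (m : ℝ) : ℕ :=
  sSup {e : ℕ | ∃ G : SimpleGraph (Fin n),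
    H.Free G ∧ (G.indepNum : ℝ) < m ∧ G.edgeSet.ncard = e}

/-- The upper Ramsey-Turán density of `H` with respect to `f`: the limit superior, as `n → ∞`, of
`RT(n, H, f n) / n ^ 2`. The sequence takes values in `[0, 1/2]`, so this is a genuine real
limit superior. -/
noncomputable def upperRamseyTuranDensity {W : Type*} (H : SimpleGraph W) (f : ℕ → ℝ) : ℝ :=
  limsup (fun n : ℕ => (ramseyTuran n H (f n) : ℝ) / (n : ℝ) ^ 2) atTop

/-! Let `G` be `K_{2t}`-free with independence number below `Q(t, n/ω)`. Every set of at least `n/ω`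
vertices then contains a `K_t` and, by the hypothesis comparing the two values of `Q`, every set of
at least `⌊f n⌋` vertices contains a `K_p`.

The `K_p`s limit the reduced graph. If `G` had `δ n^q` ordered `q`-cliques, iterated dependent
random choice would replace each of the `q` coordinates by a `p`-clique and build a `K_{pq}`, which
contains a `K_{2t}` (`exists_isNClique_of_many_tuples`). With so few `q`-cliques, the reduced graph
from the regularity lemma has no `K_q`, and Turán's theorem gives the factor `1 - 1/(q-1)`.

The `K_t`s limit densities: a pair of linear-sized sets of density above `1 - 1/t + ε` contains a
`K_{2t}` (`exists_isNClique_two_mul`), which gives the factor `1 - 1/t`. The two bounds multiply in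
`exists_card_edgeFinset_le`. -/

namespace SimpleGraph

open Finset

/-! ### Dependent random choice and large cliques -/

/-- Dependent random choice for a relation: some `s`-tuple `T` has a dense common link and is not
contained in any of the small sets `C b`. -/
theorem exists_tuple_dense_link {V X β : Type*} [Fintype V] [DecidableEq V] [Fintype X]
    [Nonempty X] [Nonempty V]
    (r : V → X → Prop) [∀ v x, Decidable (r v x)] (s : ℕ) {δ ρ θ m : ℝ} (hδ : 0 ≤ δ)
    (hρ : 0 < ρ)
    (hr : δ * (Fintype.card V * Fintype.card X) ≤ ∑ x, (#{v | r v x} : ℝ))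
    (B : Finset β) (C : β → Finset V) (hC : ∀ b ∈ B, (#(C b) : ℝ) ≤ m)
    (hB : #B * m ^ s ≤ (Fintype.card V : ℝ) ^ s * θ) (hle : ρ + θ ≤ δ ^ s) :
    ∃ T : Fin s → V, ρ * Fintype.card X ≤ (#{x | ∀ j, r (T j) x} : ℝ) ∧
      ∀ b ∈ B, ∃ j, T j ∉ C b := by
  by_contra! hcon
  have hX : (0 : ℝ) < Fintype.card X := by exact_mod_cast Fintype.card_pos
  have hV : (0 : ℝ) < Fintype.card V := by exact_mod_cast Fintype.card_pos
  -- First moment by contradiction: a tuple with a dense link lies in some `C b`, so that the count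
  -- of such `b` covers the whole of `X`. Summing over all `T` contradicts the convexity bound
  -- `hpow`.
  have hpt : ∀ T : Fin s → V, (#{x | ∀ j, r (T j) x} : ℝ) <
      Fintype.card X * (ρ + #{b ∈ B | ∀ j, T j ∈ C b}) := by
    intro T
    by_cases h : ρ * Fintype.card X ≤ (#{x | ∀ j, r (T j) x} : ℝ)
    · obtain ⟨b, hb, hbT⟩ := hcon T h
      have h1 : (1 : ℝ) ≤ #{b ∈ B | ∀ j, T j ∈ C b} := by
        exact_mod_cast card_pos.2 ⟨b, by simp [hb, hbT]⟩
      have h2 : (#{x | ∀ j, r (T j) x} : ℝ) ≤ Fintype.card X := by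
        exact_mod_cast card_le_univ _
      nlinarith
    · have h1 : (0 : ℝ) ≤ #{b ∈ B | ∀ j, T j ∈ C b} := by positivity
      nlinarith
  have hsum : ∑ T : Fin s → V, (#{x | ∀ j, r (T j) x} : ℝ) = ∑ x, (#{v | r v x} : ℝ) ^ s := by
    have h1 : ∀ T : Fin s → V, (#{x | ∀ j, r (T j) x} : ℝ)
        = ∑ x, if ∀ j, r (T j) x then 1 else 0 := fun T ↦ by simp
    simp_rw [h1]
    rw [sum_comm]
    refine sum_congr rfl fun x _ ↦ ?_
    have h2 : (Finset.univ.filter fun T : Fin s → V ↦ ∀ j, r (T j) x)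
        = Fintype.piFinset fun _ ↦ {v | r v x} := by
      ext T; simp [Fintype.mem_piFinset]
    rw [← Nat.cast_pow, ← sum_filter, h2]
    simp
  have hbad : ∑ T : Fin s → V, (#{b ∈ B | ∀ j, T j ∈ C b} : ℝ) ≤ #B * m ^ s := by
    have h1 : ∀ T : Fin s → V, (#{b ∈ B | ∀ j, T j ∈ C b} : ℝ)
        = ∑ b ∈ B, if ∀ j, T j ∈ C b then 1 else 0 := fun T ↦ by simp
    simp_rw [h1]
    rw [sum_comm, ← nsmul_eq_mul]
    refine sum_le_card_nsmul _ _ _ fun b hb ↦ ?_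
    have h2 : (Finset.univ.filter fun T : Fin s → V ↦ ∀ j, T j ∈ C b)
        = Fintype.piFinset fun _ ↦ C b := by
      ext T; simp [Fintype.mem_piFinset]
    rw [← sum_filter, h2]
    simp only [sum_const, Fintype.card_piFinset, prod_const, card_univ, Fintype.card_fin,
      nsmul_eq_mul, mul_one, Nat.cast_pow]
    gcongr
    exact hC b hb
  have hpow : Fintype.card X * (δ * Fintype.card V) ^ s ≤ ∑ x, (#{v | r v x} : ℝ) ^ s := by
    cases s with
    | zero => simp
    | succ n =>
      refine le_trans ?_ (pow_sum_div_card_le_sum_pow (fun _ _ ↦ by positivity) n)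
      rw [card_univ, le_div_iff₀ (by positivity)]
      refine le_trans (le_of_eq ?_) (pow_le_pow_left₀ (by positivity) hr (n + 1))
      ring
  have hlt : ∑ T : Fin s → V, (#{x | ∀ j, r (T j) x} : ℝ) <
      ∑ T : Fin s → V, Fintype.card X * (ρ + #{b ∈ B | ∀ j, T j ∈ C b} : ℝ) :=
    sum_lt_sum_of_nonempty univ_nonempty fun T _ ↦ hpt T
  rw [hsum, ← mul_sum, sum_add_distrib, sum_const, card_univ, Fintype.card_fun,
    Fintype.card_fin, nsmul_eq_mul, Nat.cast_pow] at hlt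
  have h3 := hpow.trans_lt hlt
  have h4 := lt_of_mul_lt_mul_left h3 hX.le
  rw [mul_pow] at h4
  have h5 : (0 : ℝ) < (Fintype.card V : ℝ) ^ s := by positivity
  nlinarith

theorem isNClique_union {V : Type*} [DecidableEq V] {G : SimpleGraph V} {a b : ℕ}
    {K L : Finset V} (hK : G.IsNClique a K) (hL : G.IsNClique b L)
    (hKL : ∀ u ∈ K, ∀ v ∈ L, G.Adj u v) : G.IsNClique (a + b) (K ∪ L) := by
  refine ⟨?_, ?_⟩
  · rw [coe_union]
    intro u hu v hv huv
    rcases hu with hu | hu <;> rcases hv with hv | hv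
    · exact hK.1 hu hv huv
    · exact hKL u hu v hv
    · exact (hKL v hv u hu).symm
    · exact hL.1 hu hv huv
  · rw [card_union_of_disjoint, hK.2, hL.2]
    rw [Finset.disjoint_left]
    exact fun v hv hv' ↦ G.loopless.irrefl v (hKL v hv v hv')

/-- If every set of at least `m` vertices contains a `p`-clique, then a graph with many ordered
`k`-cliques contains a `(p * k)`-clique. -/
theorem exists_isNClique_of_many_tuples {V : Type*} [Fintype V] [DecidableEq V] [Nonempty V]
    (G : SimpleGraph V) {p s : ℕ} (hs : 1 ≤ s) {m : ℝ} (hm : 0 ≤ m)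
    (hM : ∀ A : Finset V, m ≤ #A → ∃ K ⊆ A, G.IsNClique p K) (k : ℕ) :
    ∀ (H : Finset (Fin k → V)) (δ : ℝ), (∀ x ∈ H, Pairwise fun i j ↦ G.Adj (x i) (x j)) →
      0 < δ → δ ≤ 1 / 2 → δ * (Fintype.card V : ℝ) ^ k ≤ #H →
      (Fintype.card V : ℝ) ^ (p * k) * m ^ s ≤ (Fintype.card V : ℝ) ^ s * δ ^ ((2 * s) ^ k) →
      ∃ K, G.IsNClique (p * k) K ∧ ∀ v ∈ K, ∃ x ∈ H, ∃ i, x i = v := by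
  classical
  have hV1 : (1 : ℝ) ≤ Fintype.card V := by exact_mod_cast Fintype.card_pos
  induction k with
  | zero => exact fun H δ _ _ _ _ _ ↦ ⟨∅, by simp [isNClique_iff], by simp⟩
  | succ k ih =>
    intro H δ hadj hδ hδ2 hcard hpar
    have hδs : δ ^ s ≤ 1 / 2 := (pow_le_of_le_one hδ.le (by linarith) (by omega)).trans hδ2
    have hδs0 : 0 < δ ^ s := by positivity
    -- Restricting to first coordinates of `H` keeps the new clique on vertices of tuples in `H`, as
    -- the induction requires.
    set P : Finset V := {v | ∃ x : Fin k → V, (Fin.cons v x : Fin (k + 1) → V) ∈ H} with hP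
    set C : Finset V → Finset V := fun R ↦ {v ∈ P | ∀ u ∈ R, G.Adj u v} with hC
    set B : Finset (Finset V) := {R ∈ powersetCard (p * k) univ | (#(C R) : ℝ) < m} with hB
    have hBcard : (#B : ℝ) ≤ (Fintype.card V : ℝ) ^ (p * k) := by
      have h1 : #B ≤ Fintype.card V ^ (p * k) := by
        refine (card_filter_le _ _).trans ?_
        rw [card_powersetCard, card_univ]
        exact Nat.choose_le_pow _ _
      exact_mod_cast h1
    have hθ : δ ^ ((2 * s) ^ (k + 1)) ≤ δ ^ (2 * s) :=
      pow_le_pow_of_le_one hδ.le (by linarith) (Nat.le_self_pow (by omega) _)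
    -- Density drops from `δ` to `δ ^ (2 * s)` per coordinate, whence the exponent `(2 * s) ^ k`.
    -- Half of `δ ^ s` would suffice for `ρ + θ`, and `δ ^ (2 * s)` is at most that.
    obtain ⟨T, hT, hTB⟩ : ∃ T : Fin s → V, δ ^ (2 * s) * Fintype.card (Fin k → V) ≤
        (#{x : Fin k → V | ∀ j, (Fin.cons (T j) x : Fin (k + 1) → V) ∈ H} : ℝ) ∧
        ∀ b ∈ B, ∃ j, T j ∉ C b := by
      refine exists_tuple_dense_link (X := Fin k → V)
        (fun v x ↦ (Fin.cons v x : Fin (k + 1) → V) ∈ H) s (δ := δ) (ρ := δ ^ (2 * s))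
        (θ := δ ^ (2 * s)) (m := m) hδ.le (by positivity) ?_ B C ?_ ?_ ?_
      · refine le_trans (le_of_eq ?_) (hcard.trans (le_of_eq ?_))
        · simp [pow_succ']
        · rw [← Nat.cast_sum]
          congr 1
          rw [← card_sigma]
          refine card_bij' (fun y _ ↦ ⟨Fin.tail y, y 0⟩) (fun a _ ↦ Fin.cons a.2 a.1) ?_ ?_ ?_ ?_
          · intro y hy; simpa using hy
          · rintro ⟨x, v⟩ h; simpa using h
          · intro y _; simp
          · rintro ⟨x, v⟩ _; simp
      · exact fun R hR ↦ (mem_filter.1 hR).2.le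
      · refine le_trans ?_ (hpar.trans ?_)
        · gcongr
          refine hBcard.trans ?_
          gcongr
          omega
        · gcongr
      · have : δ ^ (2 * s) = δ ^ s * δ ^ s := by rw [two_mul, pow_add]
        nlinarith
    obtain ⟨K, hK, hKH⟩ := ih {x | ∀ j, (Fin.cons (T j) x : Fin (k + 1) → V) ∈ H} (δ ^ (2 * s))
      (fun x hx i j hij ↦ by
        have := hadj _ ((mem_filter.1 hx).2 ⟨0, hs⟩) (i := i.succ) (j := j.succ)
          (by simpa using hij)
        simpa using this)
      (by positivity)
      ((pow_le_pow_of_le_one hδ.le (by linarith) (by omega : s ≤ 2 * s)).trans hδs)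
      (by simpa using hT)
      (by
        rw [← pow_mul, ← pow_succ']
        refine le_trans ?_ hpar
        gcongr
        omega)
    have hKT : ∀ u ∈ K, ∀ j, G.Adj u (T j) ∧ ∃ x ∈ H, ∃ i, x i = u := by
      intro u hu j
      obtain ⟨x, hx, i, rfl⟩ := hKH u hu
      have hxj := (mem_filter.1 hx).2 j
      refine ⟨?_, _, hxj, i.succ, by simp⟩
      simpa using hadj _ hxj (i := i.succ) (j := 0) (Fin.succ_ne_zero i)
    have hTP : ∀ j, T j ∈ P := by
      intro j
      have hne : (0 : ℝ) < #{x : Fin k → V | ∀ j, (Fin.cons (T j) x : Fin (k + 1) → V) ∈ H} :=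
        lt_of_lt_of_le (by positivity) hT
      obtain ⟨x, hx⟩ := card_pos.1 (by exact_mod_cast hne)
      exact mem_filter.2 ⟨mem_univ _, x, (mem_filter.1 hx).2 j⟩
    -- Each vertex of `K` lies in a tuple extended by every `T j`, so all `T j` lie in `C K`; the
    -- choice of `T` forbids this when `C K` is small.
    have hKC : m ≤ #(C K) := by
      by_contra! hlt
      obtain ⟨j, hj⟩ := hTB K (mem_filter.2 ⟨mem_powersetCard.2 ⟨subset_univ _, hK.2⟩, hlt⟩)
      exact hj (mem_filter.2 ⟨hTP j, fun u hu ↦ (hKT u hu j).1⟩)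
    obtain ⟨L, hL, hLp⟩ := hM _ hKC
    refine ⟨K ∪ L, ?_, ?_⟩
    · rw [mul_add_one]
      exact isNClique_union hK hLp fun u hu v hv ↦ (mem_filter.1 (hL hv)).2 u hu
    · intro v hv
      rcases mem_union.1 hv with hv | hv
      · exact (hKT v hv ⟨0, hs⟩).2
      · obtain ⟨x, hx⟩ := (mem_filter.1 (mem_filter.1 (hL hv)).1).2
        exact ⟨_, hx, 0, by simp⟩

/-! ### Clique counting and dense pairs -/

/-- A family of sets between which all large subsets span many edges contains many ordered
cliques, one vertex from each set. -/
theorem pow_le_card_tuples_of_dense {V : Type*} [Fintype V] [DecidableEq V] (G : SimpleGraph V)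
    [DecidableRel G.Adj] {d η β : ℝ} (hd : 0 < d) (hd1 : d ≤ 1) (hη : 0 < η) {q : ℕ}
    (hq : 1 ≤ q) (hβ : q * η ≤ β) (k : ℕ) :
    ∀ (A : Fin k → Finset V), k ≤ q → (∀ i, 2 * β ≤ #(A i) * d ^ k) →
      (∀ i j, i ≠ j → ∀ X ⊆ A i, ∀ Y ⊆ A j, η ≤ #X → η ≤ #Y →
        d * (#X * #Y) ≤ (#(G.interedges X Y) : ℝ)) →
      β ^ k ≤ (#{x : Fin k → V | (∀ i, x i ∈ A i) ∧ ∀ i j, i ≠ j → G.Adj (x i) (x j)} : ℝ) := by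
  classical
  have hq' : (1 : ℝ) ≤ q := by exact_mod_cast hq
  have hβ0 : 0 < β := by nlinarith
  induction k with
  | zero =>
    intro A _ _ _
    have h : (#{x : Fin 0 → V | (∀ i, x i ∈ A i) ∧ ∀ i j, i ≠ j → G.Adj (x i) (x j)}) = 1 := by
      rw [filter_true_of_mem fun x _ ↦ ⟨fun i ↦ i.elim0, fun i ↦ i.elim0⟩]
      simp
    rw [h]; simp
  | succ k ih =>
    intro A hk hA hden
    have hsize : ∀ i, 2 * β ≤ #(A i) := fun i ↦ (hA i).trans <|
      mul_le_of_le_one_right (by positivity) (pow_le_one₀ hd.le hd1)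
    set bad : Fin k → Finset V :=
      fun i ↦ {v ∈ A 0 | (#{w ∈ A i.succ | G.Adj v w} : ℝ) < d * #(A i.succ)} with hbad
    have hbadcard : ∀ i, (#(bad i) : ℝ) ≤ η := by
      intro i
      by_contra! hlt
      have h1 := hden 0 i.succ (Fin.succ_ne_zero i).symm (bad i) (filter_subset _ _)
        (A i.succ) subset_rfl hlt.le (by nlinarith [hsize i.succ])
      have h2 : (#(G.interedges (bad i) (A i.succ)) : ℝ)
          = ∑ v ∈ bad i, (#{w ∈ A i.succ | G.Adj v w} : ℝ) := by
        rw [interedges_def, ← Nat.cast_sum, card_filter, sum_product]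
        simp_rw [card_filter]
      have h3 : ∑ v ∈ bad i, (#{w ∈ A i.succ | G.Adj v w} : ℝ)
          < ∑ v ∈ bad i, d * #(A i.succ) :=
        sum_lt_sum_of_nonempty (card_pos.1 (by exact_mod_cast hη.trans hlt))
          fun v hv ↦ (mem_filter.1 hv).2
      rw [sum_const, nsmul_eq_mul] at h3
      nlinarith
    -- Of the at least `2 * β` vertices of `A 0`, at most `k * η ≤ β` are lost. For the others, each
    -- neighbourhood shrinks by a factor of at most `d`, matching the drop from `d ^ (k + 1)` to `d
    -- ^ k`.
    set good : Finset V := A 0 \ univ.biUnion bad with hgood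
    have hgoodcard : β ≤ #good := by
      have h1 : (#(univ.biUnion bad) : ℝ) ≤ k * η := by
        refine (Nat.cast_le.2 card_biUnion_le).trans ?_
        rw [Nat.cast_sum]
        refine (sum_le_sum fun i _ ↦ hbadcard i).trans ?_
        simp
      have h2 : (#(A 0) : ℝ) ≤ #good + #(univ.biUnion bad) := by
        exact_mod_cast card_le_card_sdiff_add_card
      have h3 : (k : ℝ) * η ≤ q * η := by
        gcongr
        omega
      linarith [hsize 0]
    have hlink : ∀ v ∈ good, β ^ k ≤ (#{x : Fin k → V | (∀ i, x i ∈ {w ∈ A i.succ | G.Adj v w}) ∧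
        ∀ i j, i ≠ j → G.Adj (x i) (x j)} : ℝ) := by
      intro v hv
      refine ih _ (by omega) (fun i ↦ ?_) fun i j hij X hX Y hY ↦
        hden i.succ j.succ (by simpa using hij) X (hX.trans (filter_subset _ _)) Y
          (hY.trans (filter_subset _ _))
      have h1 : v ∉ bad i := fun h ↦ (Finset.mem_sdiff.1 hv).2 (mem_biUnion.2 ⟨i, mem_univ _, h⟩)
      have h2 : d * #(A i.succ) ≤ (#{w ∈ A i.succ | G.Adj v w} : ℝ) := by
        by_contra! h
        exact h1 (mem_filter.2 ⟨(Finset.mem_sdiff.1 hv).1, h⟩)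
      calc 2 * β ≤ #(A i.succ) * d ^ (k + 1) := hA _
        _ = d * #(A i.succ) * d ^ k := by ring
        _ ≤ _ := by gcongr
    have hinj : #(good.sigma fun v ↦ {x : Fin k → V | (∀ i, x i ∈ {w ∈ A i.succ | G.Adj v w}) ∧
        ∀ i j, i ≠ j → G.Adj (x i) (x j)}) ≤
        #{x : Fin (k + 1) → V | (∀ i, x i ∈ A i) ∧ ∀ i j, i ≠ j → G.Adj (x i) (x j)} := by
      refine card_le_card_of_injOn (fun a ↦ Fin.cons a.1 a.2) ?_ ?_
      · rintro ⟨v, x⟩ h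
        simp only [coe_sigma, Set.mem_sigma_iff, mem_coe, mem_filter, mem_univ, true_and] at h ⊢
        obtain ⟨hv, hx, hpw⟩ := h
        refine ⟨fun i ↦ ?_, fun i j hij ↦ ?_⟩
        · cases i using Fin.cases with
          | zero => exact (Finset.mem_sdiff.1 hv).1
          | succ i => exact (hx i).1
        · cases i using Fin.cases with
          | zero =>
            cases j using Fin.cases with
            | zero => exact (hij rfl).elim
            | succ j => exact (hx j).2
          | succ i =>
            cases j using Fin.cases with
            | zero => exact (hx i).2.symm
            | succ j => exact hpw i j (by simpa using hij)
      · rintro ⟨v, x⟩ _ ⟨w, y⟩ _ h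
        obtain ⟨rfl, rfl⟩ := Fin.cons_injective2 h
        rfl
    calc β ^ (k + 1) = β * β ^ k := pow_succ' _ _
      _ ≤ #good * β ^ k := by gcongr
      _ = ∑ v ∈ good, β ^ k := by simp
      _ ≤ _ := (sum_le_sum hlink).trans (by rw [← Nat.cast_sum, ← card_sigma]; exact_mod_cast hinj)

/-- If every large set contains a `t`-clique, then pairs of large sets of density above `1 - 1 / t`
span a `(t + t)`-clique. -/
theorem exists_isNClique_two_mul {V : Type*} [Fintype V] [DecidableEq V] (G : SimpleGraph V)
    [DecidableRel G.Adj] {t : ℕ} (ht : 1 ≤ t) {m ε : ℝ} (hε : 0 < ε)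
    (hm : ∀ A : Finset V, m ≤ #A → ∃ K ⊆ A, G.IsNClique t K) (A B : Finset V)
    (hA : m ≤ ε / 2 * #A) (hB : m ≤ ε / 2 * #B)
    (hAB : (1 - 1 / (t : ℝ) + ε) * (#A * #B) < #(G.interedges A B)) :
    ∃ K, G.IsNClique (t + t) K := by
  have ht' : (1 : ℝ) ≤ t := by exact_mod_cast ht
  set D : Finset V := {v ∈ A | (1 - 1 / (t : ℝ) + ε / 2) * #B ≤ #{w ∈ B | G.Adj v w}} with hD
  have hDcard : ε / 2 * #A ≤ #D := by
    have hB0 : (0 : ℝ) < #B := by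
      rcases B.eq_empty_or_nonempty with rfl | h
      · simp [interedges_def] at hAB
      · exact_mod_cast h.card_pos
    have h2 : (#(G.interedges A B) : ℝ) = ∑ v ∈ A, (#{w ∈ B | G.Adj v w} : ℝ) := by
      rw [interedges_def, ← Nat.cast_sum, card_filter, sum_product]
      simp_rw [card_filter]
    have h3 : ∑ v ∈ A, (#{w ∈ B | G.Adj v w} : ℝ) ≤
        ∑ v ∈ A, ((1 - 1 / (t : ℝ) + ε / 2) * #B +
          if (1 - 1 / (t : ℝ) + ε / 2) * #B ≤ #{w ∈ B | G.Adj v w} then (#B : ℝ) else 0) := by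
      refine sum_le_sum fun v _ ↦ ?_
      have h4 : (#{w ∈ B | G.Adj v w} : ℝ) ≤ #B := by exact_mod_cast card_filter_le _ _
      have h5 : 0 ≤ (1 - 1 / (t : ℝ) + ε / 2) * #B := by
        have : 1 / (t : ℝ) ≤ 1 := by rw [div_le_one] <;> linarith
        have : 0 ≤ 1 - 1 / (t : ℝ) + ε / 2 := by linarith
        positivity
      split_ifs with h <;> linarith
    rw [sum_add_distrib, ← sum_filter, sum_const, sum_const, nsmul_eq_mul, nsmul_eq_mul, ← hD] at h3
    have h6 : (ε / 2 * #A) * #B ≤ #D * #B := by nlinarith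
    exact le_of_mul_le_mul_right h6 hB0
  obtain ⟨K, hKD, hK⟩ := hm D (hA.trans hDcard)
  -- Each of the `t` vertices of `K` misses at most `(1/t - ε/2) * #B` of `B`, so a fraction `t * ε
  -- / 2` survives in common.
  set N : Finset V := {w ∈ B | ∀ v ∈ K, G.Adj v w} with hN
  have hNcard : ε / 2 * #B ≤ #N := by
    have h1 : B \ N ⊆ K.biUnion fun v ↦ {w ∈ B | ¬ G.Adj v w} := by
      intro w hw
      rw [Finset.mem_sdiff] at hw
      obtain ⟨hwB, hwN⟩ := hw
      have : ¬ ∀ v ∈ K, G.Adj v w := fun h ↦ hwN (mem_filter.2 ⟨hwB, h⟩)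
      push Not at this
      obtain ⟨v, hv, hvw⟩ := this
      exact mem_biUnion.2 ⟨v, hv, mem_filter.2 ⟨hwB, hvw⟩⟩
    have h2 : (#(B \ N) : ℝ) ≤ ∑ v ∈ K, (#{w ∈ B | ¬ G.Adj v w} : ℝ) := by
      exact_mod_cast (card_le_card h1).trans card_biUnion_le
    have h3 : ∀ v ∈ K, (#{w ∈ B | ¬ G.Adj v w} : ℝ) ≤ (1 / (t : ℝ) - ε / 2) * #B := by
      intro v hv
      have h4 := (mem_filter.1 (hKD hv)).2
      have h5 : (#{w ∈ B | G.Adj v w} : ℝ) + #{w ∈ B | ¬ G.Adj v w} = #B := by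
        exact_mod_cast card_filter_add_card_filter_not (s := B) (fun w ↦ G.Adj v w)
      linarith
    have h6 := h2.trans (sum_le_sum h3)
    rw [sum_const, hK.2, nsmul_eq_mul] at h6
    have h7 : (#B : ℝ) = #(B \ N) + #N := by
      exact_mod_cast (card_sdiff_add_card_eq_card (filter_subset _ _)).symm
    have h8 : (t : ℝ) * ((1 / (t : ℝ) - ε / 2) * #B) = #B - t * (ε / 2 * #B) := by
      field_simp
    have h9 : (0 : ℝ) ≤ ε / 2 * #B := by positivity
    nlinarith
  obtain ⟨L, hLN, hL⟩ := hm N (hB.trans hNcard)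
  exact ⟨K ∪ L, isNClique_union hK hL fun u hu v hv ↦ (mem_filter.1 (hLN hv)).2 u hu⟩

/-! ### Turán's theorem and the reduced graph -/

theorem two_mul_card_edgeFinset_le_of_cliqueFree {V : Type*} [Fintype V] (H : SimpleGraph V)
    [DecidableRel H.Adj] {q : ℕ} (hq : 2 ≤ q) (hH : H.CliqueFree q) :
    (2 * #H.edgeFinset : ℝ) ≤ (1 - 1 / ((q : ℝ) - 1)) * (Fintype.card V : ℝ) ^ 2 := by
  obtain ⟨r, rfl⟩ : ∃ r, q = r + 1 := ⟨q - 1, by omega⟩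
  have h1 := hH.card_edgeFinset_le
  simp only at h1
  rw [← card_edgeFinset_turanGraph] at h1
  have h2 : 2 * r * #H.edgeFinset ≤ (r - 1) * Fintype.card V ^ 2 :=
    (Nat.mul_le_mul_left _ h1).trans mul_card_edgeFinset_turanGraph_le
  have hr : (1 : ℝ) ≤ r := by exact_mod_cast (by omega : 1 ≤ r)
  have h3 : (2 * r * #H.edgeFinset : ℝ) ≤ (r - 1) * (Fintype.card V : ℝ) ^ 2 := by
    have := (Nat.cast_le (α := ℝ)).2 h2
    push_cast [Nat.cast_sub (show 1 ≤ r by omega)] at this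
    exact this
  push_cast
  rw [add_sub_cancel_right, one_sub_div (by positivity), div_mul_eq_mul_div,
    le_div_iff₀ (by positivity)]
  linarith

/-- The blow-up of the reduced graph of the partition `P`: vertices are adjacent when they lie in
distinct parts forming an `ε`-uniform pair of density at least `δ`. -/
def reducedBlowup {V : Type*} [Fintype V] [DecidableEq V] (G : SimpleGraph V) [DecidableRel G.Adj]
    (P : Finpartition (univ : Finset V)) (ε δ : ℝ) : SimpleGraph V where
  Adj a b := ∃ U ∈ P.parts, ∃ W ∈ P.parts, a ∈ U ∧ b ∈ W ∧ U ≠ W ∧ G.IsUniform ε U W ∧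
    δ ≤ G.edgeDensity U W
  symm.symm a b := by
    rintro ⟨U, UP, W, WP, xU, yW, UW, GUW, εUW⟩
    refine ⟨W, WP, U, UP, yW, xU, UW.symm, GUW.symm, ?_⟩
    rwa [edgeDensity_comm]
  loopless.irrefl a := by
    rintro ⟨U, UP, W, WP, xU, yW, UW, -⟩
    exact UW (P.disjoint.elim UP WP (not_disjoint_iff.2 ⟨a, xU, yW⟩))

variable {V : Type*} [Fintype V] [DecidableEq V] {G : SimpleGraph V} [DecidableRel G.Adj]
  {P : Finpartition (univ : Finset V)}

theorem le_card_part_of_isEquipartition [Nonempty V] (hP : P.IsEquipartition) {K : ℕ}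
    (hK : #P.parts ≤ K) :
    1 ≤ Fintype.card V / #P.parts ∧
    (Fintype.card V : ℝ) / (2 * K) ≤ (Fintype.card V / #P.parts : ℕ) ∧
    ∀ U ∈ P.parts, Fintype.card V / #P.parts ≤ #U ∧ #U ≤ 2 * (Fintype.card V / #P.parts) := by
  have hpos : 0 < #P.parts := card_pos.2 (P.parts_nonempty univ_nonempty.ne_empty)
  have hle : #P.parts ≤ Fintype.card V := P.card_parts_le_card
  have h1 : 1 ≤ Fintype.card V / #P.parts := (Nat.one_le_div_iff hpos).2 hle
  refine ⟨h1, ?_, fun U hU ↦ ⟨hP.average_le_card_part hU, ?_⟩⟩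
  · have hKpos : (0 : ℝ) < K := by exact_mod_cast hpos.trans_le hK
    rw [div_le_iff₀ (by positivity)]
    have h2 : Fintype.card V ≤ (Fintype.card V / #P.parts) * (2 * K) := by
      have h3 := Nat.div_add_mod (Fintype.card V) #P.parts
      have h4 := Nat.mod_lt (Fintype.card V) hpos
      nlinarith
    exact_mod_cast h2
  · have h2 := hP.card_part_le_average_add_one hU
    rw [card_univ] at h2
    omega

/-- A clique in the blow-up of the reduced graph forces many ordered cliques in `G`. -/
theorem le_card_tuples_of_not_cliqueFree_reducedBlowup [Nonempty V] (hP : P.IsEquipartition)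
    {K q : ℕ} (hK : #P.parts ≤ K) (hq : 1 ≤ q) {ε d : ℝ} (hε : 0 < ε) (hd : 0 < d) (hd1 : d ≤ 1)
    (hεd : 4 * q * ε ≤ d ^ q) (h : ¬ (G.reducedBlowup P ε (d + ε)).CliqueFree q) :
    (d ^ q / (4 * K)) ^ q * (Fintype.card V : ℝ) ^ q ≤
      (#{x : Fin q → V | ∀ i j, i ≠ j → G.Adj (x i) (x j)} : ℝ) := by
  obtain ⟨hN, hNK, hparts⟩ := le_card_part_of_isEquipartition hP hK
  set N := Fintype.card V / #P.parts with hNdef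
  have hN' : (1 : ℝ) ≤ N := by exact_mod_cast hN
  rw [not_cliqueFree_iff_top_isContained] at h
  obtain ⟨φ⟩ := h
  choose A hAP hA using fun i ↦ P.exists_mem (mem_univ (φ i))
  -- Parts have at most `2 * N` vertices, so the threshold `2 * ε * N` suffices for uniformity.
  have hdense : ∀ i j, i ≠ j → ∀ X ⊆ A i, ∀ Y ⊆ A j, 2 * ε * N ≤ #X → 2 * ε * N ≤ #Y →
      d * (#X * #Y) ≤ (#(G.interedges X Y) : ℝ) := by
    intro i j hij X hX Y hY hXc hYc
    obtain ⟨U, UP, W, WP, xU, yW, UW, hunif, hden⟩ :=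
      φ.toHom.map_adj (show (completeGraph (Fin q)).Adj i j from hij)
    obtain rfl := P.disjoint.elim UP (hAP i) (not_disjoint_iff.2 ⟨_, xU, hA i⟩)
    obtain rfl := P.disjoint.elim WP (hAP j) (not_disjoint_iff.2 ⟨_, yW, hA j⟩)
    have hsz : ∀ i, (#(A i) : ℝ) * ε ≤ 2 * ε * N := by
      intro i
      have : (#(A i) : ℝ) ≤ 2 * N := by exact_mod_cast (hparts _ (hAP i)).2
      nlinarith
    have h1 := (abs_lt.1 (hunif hX hY ((hsz i).trans hXc) ((hsz j).trans hYc))).1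
    have hXpos : (0 : ℝ) < #X := lt_of_lt_of_le (by positivity) hXc
    have hYpos : (0 : ℝ) < #Y := lt_of_lt_of_le (by positivity) hYc
    have h2 : d ≤ (G.edgeDensity X Y : ℝ) := by linarith
    rw [edgeDensity_def] at h2
    push_cast at h2
    rwa [le_div_iff₀ (by positivity)] at h2
  have hmain := pow_le_card_tuples_of_dense G hd hd1 (η := 2 * ε * N) (β := N * d ^ q / 2)
    (by positivity) hq (by nlinarith) q A le_rfl (fun i ↦ by
      have : (N : ℝ) ≤ #(A i) := by exact_mod_cast (hparts _ (hAP i)).1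
      calc 2 * (N * d ^ q / 2) = N * d ^ q := by ring
        _ ≤ _ := by gcongr) hdense
  calc (d ^ q / (4 * K)) ^ q * (Fintype.card V : ℝ) ^ q
      = (d ^ q / 2 * (Fintype.card V / (2 * K))) ^ q := by
        rw [← mul_pow]; congr 1; ring
    _ ≤ (N * d ^ q / 2) ^ q := by
        gcongr
        calc _ ≤ d ^ q / 2 * (N : ℝ) := by gcongr
          _ = _ := by ring
    _ ≤ _ := hmain
    _ ≤ _ := by
        gcongr with x
        exact fun h ↦ h.2

/-- Up to few exceptions, the edges of a graph lie between dense uniform pairs of a uniform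
partition; if these pairs have density at most `κ`, the edges are controlled by the blow-up of the
reduced graph. -/
theorem two_mul_card_edgeFinset_le_reducedBlowup [Nonempty V] (hP : P.IsEquipartition)
    {ε ε' δ κ : ℝ} (hε : 0 < ε) (hPε : P.IsUniform G ε) (hε' : 0 < ε') (hP' : 4 / ε' ≤ #P.parts)
    (hδ : 0 ≤ δ)
    [DecidableRel (G.reducedBlowup P ε δ).Adj]
    (hκ : ∀ U ∈ P.parts, ∀ W ∈ P.parts, (#(G.interedges U W) : ℝ) ≤ κ * (#U * #W)) :
    (2 * #G.edgeFinset : ℝ) ≤ (4 * ε + ε' / 2 + 4 * δ) * (Fintype.card V : ℝ) ^ 2 +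
      κ * (2 * #(G.reducedBlowup P ε δ).edgeFinset) := by
  classical
  let A := (P.nonUniforms G ε).biUnion fun (U, W) ↦ U ×ˢ W
  let B := P.parts.biUnion offDiag
  let C := (P.sparsePairs G δ).biUnion fun (U, W) ↦ G.interedges U W
  let S := P.parts.offDiag.filter fun (U, W) ↦ G.IsUniform ε U W ∧ δ ≤ G.edgeDensity U W
  let D := S.biUnion fun (U, W) ↦ G.interedges U W
  have hcover : (univ.filter fun x : V × V ↦ G.Adj x.1 x.2) ⊆ A ∪ B ∪ C ∪ D := by
    rintro ⟨x, y⟩ hxy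
    have hxy : G.Adj x y := (mem_filter.1 hxy).2
    obtain ⟨U, hU, xU⟩ := P.exists_mem (mem_univ x)
    obtain ⟨W, hW, yW⟩ := P.exists_mem (mem_univ y)
    simp only [mem_union, A, B, C, D, S, mem_biUnion, Prod.exists, Finpartition.mk_mem_nonUniforms,
      Finpartition.mk_mem_sparsePairs, mem_filter, mem_offDiag, mem_product, mk_mem_interedges_iff]
    by_cases hUW : U = W
    · subst hUW
      exact Or.inl (Or.inl (Or.inr ⟨U, hU, xU, yW, hxy.ne⟩))
    by_cases hunif : G.IsUniform ε U W
    · rcases lt_or_ge (G.edgeDensity U W : ℝ) δ with h | h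
      · exact Or.inl (Or.inr ⟨U, W, ⟨hU, hW, hUW, h⟩, xU, yW, hxy⟩)
      · exact Or.inr ⟨U, W, ⟨⟨hU, hW, hUW⟩, hunif, h⟩, xU, yW, hxy⟩
    · exact Or.inl (Or.inl (Or.inl ⟨U, W, ⟨hU, hW, hUW, hunif⟩, xU, yW⟩))
  have hAc : (#A : ℝ) ≤ 4 * ε * (Fintype.card V : ℝ) ^ 2 :=
    (hP.sum_nonUniforms_lt univ_nonempty hε hPε).le
  have hBc : (#B : ℝ) ≤ ε' / 2 * (Fintype.card V : ℝ) ^ 2 := hP.card_biUnion_offDiag_le hε' hP'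
  have hCc : (#C : ℝ) ≤ 4 * δ * (Fintype.card V : ℝ) ^ 2 := hP.card_interedges_sparsePairs_le hδ
  have hDc : (#D : ℝ) ≤ κ * (2 * #(G.reducedBlowup P ε δ).edgeFinset) := by
    -- The products over `S` are disjoint and make up exactly the ordered edges of the blow-up, so
    -- no weighted Turán theorem is needed.
    have hH : (∑ x ∈ S, #x.1 * #x.2) = 2 * #(G.reducedBlowup P ε δ).edgeFinset := by
      rw [two_mul_card_edgeFinset]
      simp_rw [← card_product]
      rw [← card_biUnion]
      · congr 1
        ext ⟨x, y⟩
        simp only [S, mem_biUnion, Prod.exists, mem_filter, mem_offDiag, mem_product, mem_univ,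
          true_and]
        constructor
        · rintro ⟨U, W, ⟨⟨hU, hW, hUW⟩, hu, hd⟩, hx, hy⟩
          exact ⟨U, hU, W, hW, hx, hy, hUW, hu, hd⟩
        · rintro ⟨U, hU, W, hW, hx, hy, hUW, hu, hd⟩
          exact ⟨U, W, ⟨⟨hU, hW, hUW⟩, hu, hd⟩, hx, hy⟩
      · rintro ⟨U, W⟩ hUW ⟨U', W'⟩ hUW' hne
        simp only [S, mem_coe, mem_filter, mem_offDiag] at hUW hUW'
        rw [Function.onFun, Finset.disjoint_left]
        rintro ⟨x, y⟩ h h'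
        simp only [mem_product] at h h'
        refine hne (Prod.ext ?_ ?_)
        · exact P.disjoint.elim hUW.1.1 hUW'.1.1 (not_disjoint_iff.2 ⟨_, h.1, h'.1⟩)
        · exact P.disjoint.elim hUW.1.2.1 hUW'.1.2.1 (not_disjoint_iff.2 ⟨_, h.2, h'.2⟩)
    have hH' : (2 * #(G.reducedBlowup P ε δ).edgeFinset : ℝ) = ∑ x ∈ S, (#x.1 * #x.2 : ℝ) := by
      exact_mod_cast hH.symm
    rw [hH', mul_sum]
    refine (Nat.cast_le.2 card_biUnion_le).trans ?_
    rw [Nat.cast_sum]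
    refine sum_le_sum fun x hx ↦ ?_
    have hx := mem_offDiag.1 (mem_filter.1 hx).1
    exact hκ _ hx.1 _ hx.2.1
  have h1 : (2 * #G.edgeFinset : ℝ) ≤ #A + #B + #C + #D := by
    have h2 : 2 * #G.edgeFinset ≤ #A + #B + #C + #D := by
      rw [two_mul_card_edgeFinset]
      refine (card_le_card hcover).trans ?_
      refine (card_union_le _ _).trans (Nat.add_le_add_right ?_ _)
      refine (card_union_le _ _).trans (Nat.add_le_add_right ?_ _)
      exact card_union_le _ _
    exact_mod_cast h2
  linarith

/-- A graph with few ordered `q`-cliques in which all pairs of large sets have density at most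
about `τ` has at most about `τ * (1 - 1 / (q - 1)) * n ^ 2 / 2` edges. -/
theorem exists_card_edgeFinset_le {q : ℕ} (hq : 2 ≤ q) {τ ε : ℝ} (hτ : 0 ≤ τ) (hε : 0 < ε)
    (hε1 : ε ≤ 1) :
    ∃ δ : ℝ, 0 < δ ∧ δ ≤ 1 / 2 ∧ ∃ γ : ℝ, 0 < γ ∧ ∃ N : ℕ, ∀ n : ℕ, N ≤ n →
      ∀ (G : SimpleGraph (Fin n)) [DecidableRel G.Adj],
        (#{x : Fin q → Fin n | ∀ i j, i ≠ j → G.Adj (x i) (x j)} : ℝ) < δ * (n : ℝ) ^ q →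
        (∀ A B : Finset (Fin n), γ * n ≤ #A → γ * n ≤ #B →
          (#(G.interedges A B) : ℝ) ≤ (τ + ε) * (#A * #B)) →
        (2 * #G.edgeFinset : ℝ) ≤ (τ * (1 - 1 / ((q : ℝ) - 1)) + 8 * ε) * (n : ℝ) ^ 2 := by
  classical
  have hq2 : (2 : ℝ) ≤ q := by exact_mod_cast hq
  set d : ℝ := ε / 2 with hd
  have hd0 : 0 < d := by positivity
  have hdq : d ^ q ≤ d := pow_le_of_le_one hd0.le (by linarith) (by omega)
  set ε₁ : ℝ := d ^ q / (4 * q) with hε₁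
  have hε₁0 : 0 < ε₁ := by positivity
  have hε₁d : ε₁ ≤ d := by
    rw [hε₁, div_le_iff₀ (by positivity)]
    nlinarith
  set l : ℕ := ⌈4 / ε⌉₊ with hl
  set K : ℕ := SzemerediRegularity.bound ε₁ l with hK
  have hK0 : (1 : ℝ) ≤ K := by exact_mod_cast Nat.succ_le_of_lt (SzemerediRegularity.bound_pos ε₁ l)
  -- The clique density forced by a `q`-clique in the blow-up, and a lower bound for the relative
  -- size of a part.
  refine ⟨(d ^ q / (4 * K)) ^ q, by positivity, ?_, 1 / (2 * K), by positivity, l + 1, ?_⟩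
  · have h1 : d ^ q / (4 * K) ≤ 1 / 2 := by
      rw [div_le_iff₀ (by positivity)]
      nlinarith
    exact (pow_le_of_le_one (by positivity) (by linarith) (by omega)).trans h1
  · intro n hn G _ hfew hdens
    have : Nonempty (Fin n) := ⟨⟨0, by omega⟩⟩
    obtain ⟨P, hP₁, hP₂, hP₃, hP₄⟩ := szemeredi_regularity G hε₁0
      (l := l) (by rw [Fintype.card_fin]; omega)
    obtain ⟨hN, hNK, hparts⟩ := le_card_part_of_isEquipartition hP₁ hP₃
    have hfree : (G.reducedBlowup P ε₁ (d + ε₁)).CliqueFree q := by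
      by_contra hcon
      have := le_card_tuples_of_not_cliqueFree_reducedBlowup hP₁ hP₃ (by omega) hε₁0 hd0
        (by linarith) (by rw [hε₁]; field_simp; rfl) hcon
      rw [Fintype.card_fin] at this
      exact this.not_gt hfew
    have hpartsize : ∀ U ∈ P.parts, 1 / (2 * (K : ℝ)) * n ≤ #U := by
      intro U hU
      have h1 : ((Fintype.card (Fin n) / #P.parts : ℕ) : ℝ) ≤ #U := by
        exact_mod_cast (hparts U hU).1
      refine le_trans (le_of_eq ?_) (hNK.trans h1)
      rw [Fintype.card_fin]; ring
    have hmain := two_mul_card_edgeFinset_le_reducedBlowup (κ := τ + ε) (δ := d + ε₁) (ε' := ε)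
      hP₁ hε₁0 hP₄ hε ((Nat.le_ceil _).trans (Nat.cast_le.2 hP₂)) (by positivity)
      fun U hU W hW ↦ hdens U W (hpartsize U hU) (hpartsize W hW)
    have hturan := two_mul_card_edgeFinset_le_of_cliqueFree _ hq hfree
    rw [Fintype.card_fin] at hmain hturan
    have h1 : 1 - 1 / ((q : ℝ) - 1) ≤ 1 := by
      have : 0 ≤ 1 / ((q : ℝ) - 1) := by
        apply div_nonneg <;> linarith
      linarith
    have hn2 : (0 : ℝ) ≤ (n : ℝ) ^ 2 := by positivity
    have h2 := mul_le_mul_of_nonneg_left hturan (add_pos_of_nonneg_of_pos hτ hε).le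
    have h3 : ε * (1 - 1 / ((q : ℝ) - 1)) * (n : ℝ) ^ 2 ≤ ε * (n : ℝ) ^ 2 := by
      gcongr
      exact mul_le_of_le_one_right hε.le h1
    have h4 : (4 * ε₁ + ε / 2 + 4 * (d + ε₁)) * (n : ℝ) ^ 2 ≤ 7 * ε * (n : ℝ) ^ 2 := by
      gcongr
      rw [hd] at *
      linarith
    linarith

/-! ### Asymptotics and the final bound -/

theorem exists_isNClique_of_indepNum_lt_ramseyQ {V : Type*} [Fintype V] [DecidableEq V]
    (G : SimpleGraph V) {t m : ℕ} (h : G.indepNum < ramseyQ t m) (A : Finset V) (hA : m ≤ #A) :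
    ∃ K ⊆ A, G.IsNClique t K := by
  obtain ⟨A', hA', hcard⟩ := exists_subset_card_eq hA
  let e : Fin m ↪ V := (A'.equivFinOfCardEq hcard).symm.toEmbedding.trans (.subtype _)
  have he : ∀ i, e i ∈ A' := fun i ↦ ((A'.equivFinOfCardEq hcard).symm i).2
  by_cases hfree : (G.comap e).CliqueFree t
  · have h1 : ramseyQ t m ≤ (G.comap e).indepNum := Nat.sInf_le ⟨G.comap e, hfree, rfl⟩
    obtain ⟨s, hs, hsc⟩ := (G.comap e).exists_isNIndepSet_indepNum
    have h2 : G.IsIndepSet (s.map e : Finset V) := by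
      rw [coe_map]
      rintro _ ⟨i, hi, rfl⟩ _ ⟨j, hj, rfl⟩ hij
      exact hs hi hj fun h ↦ hij (by rw [h])
    have h3 := h2.card_le_indepNum
    rw [card_map] at h3
    omega
  · simp only [CliqueFree, not_forall, not_not] at hfree
    obtain ⟨K, hK, hKc⟩ := hfree
    refine ⟨K.map e, fun v hv ↦ ?_, ?_, by rw [card_map, hKc]⟩
    · obtain ⟨i, -, rfl⟩ := mem_map.1 hv
      exact hA' (he i)
    · rw [coe_map]
      rintro _ ⟨i, hi, rfl⟩ _ ⟨j, hj, rfl⟩ hij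
      exact hK hi hj fun h ↦ hij (by rw [h])

end SimpleGraph

-- This is where the exponent `1 - 1/q` comes from. With `L = log n` and `s` about `L^(1/q)`, both
-- `n ^ (p * q)` and the reciprocal of `δ ^ ((2 * s) ^ q)` are `2 ^ O(L)`, while `(m / n) ^ s ≤ 2 ^
-- (-W * L)`. Hence a large constant `W` wins.
open Real in
theorem eventually_pow_mul_pow_le (p : ℕ) {q : ℕ} (hq : 1 ≤ q) {δ : ℝ} (hδ : 0 < δ)
    (hδ1 : δ ≤ 1) :
    ∃ W : ℝ, ∀ᶠ n : ℕ in atTop, ∃ s : ℕ, 1 ≤ s ∧ ∀ m : ℝ, 0 ≤ m →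
      m ≤ n * (2 : ℝ) ^ (-(W * logb 2 n ^ (1 - 1 / (q : ℝ)))) →
      (n : ℝ) ^ (p * q) * m ^ s ≤ (n : ℝ) ^ s * δ ^ ((2 * s) ^ q) := by
  set D : ℝ := -logb 2 δ with hD
  have hD0 : 0 ≤ D := by
    have : logb 2 δ ≤ 0 := logb_nonpos (by norm_num) hδ.le hδ1
    linarith
  refine ⟨p * q + D * 4 ^ q, ?_⟩
  set W : ℝ := p * q + D * 4 ^ q with hW
  have hW0 : 0 ≤ W := by positivity
  filter_upwards [eventually_ge_atTop 2] with n hn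
  have hn' : (2 : ℝ) ≤ n := by exact_mod_cast hn
  have hn0 : (0 : ℝ) < n := by linarith
  set L : ℝ := logb 2 n with hL
  have hL1 : 1 ≤ L := by
    rw [hL, le_logb_iff_rpow_le (by norm_num) hn0]; simpa using hn'
  have hL0 : 0 < L := by linarith
  have hq0 : (q : ℝ) ≠ 0 := by exact_mod_cast (by omega : q ≠ 0)
  set R : ℝ := L ^ (1 / (q : ℝ)) with hR
  have hR1 : 1 ≤ R := one_le_rpow hL1 (by positivity)
  have hRq : R ^ q = L := by
    rw [hR, ← rpow_natCast, ← rpow_mul hL0.le, one_div_mul_cancel hq0, rpow_one]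
  refine ⟨⌈R⌉₊, Nat.one_le_ceil_iff.2 (by linarith), ?_⟩
  set s := ⌈R⌉₊ with hs
  have hRs : R ≤ s := Nat.le_ceil _
  have hsR : (s : ℝ) ≤ 2 * R := by
    have := Nat.ceil_lt_add_one (by linarith : 0 ≤ R)
    linarith
  intro m hm0 hm
  have hnpow : (n : ℝ) = 2 ^ L := (rpow_logb (by norm_num) (by norm_num) hn0).symm
  have hδpow : δ = 2 ^ (-D) := by
    rw [hD, neg_neg, rpow_logb (by norm_num) (by norm_num) hδ]
  have h1 : ((2 * s : ℕ) : ℝ) ^ q ≤ 4 ^ q * L := by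
    rw [← hRq, ← mul_pow]
    push_cast
    exact pow_le_pow_left₀ (by positivity) (by linarith) q
  have h2 : L ≤ L ^ (1 - 1 / (q : ℝ)) * s := by
    calc L = L ^ (1 - 1 / (q : ℝ)) * R := by
          rw [hR, ← rpow_add hL0, sub_add_cancel, rpow_one]
      _ ≤ _ := by gcongr
  calc (n : ℝ) ^ (p * q) * m ^ s
      ≤ (n : ℝ) ^ (p * q) * (n * (2 : ℝ) ^ (-(W * L ^ (1 - 1 / (q : ℝ))))) ^ s := by gcongr
    _ = (n : ℝ) ^ s * ((2 : ℝ) ^ (L * (p * q)) * 2 ^ (-(W * L ^ (1 - 1 / (q : ℝ))) * s)) := by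
        rw [mul_pow, ← rpow_natCast ((2 : ℝ) ^ (-(W * L ^ (1 - 1 / (q : ℝ))))) s,
          ← rpow_mul (by norm_num), rpow_mul (by norm_num) L, ← hnpow, ← Nat.cast_mul,
          rpow_natCast]
        ring
    _ ≤ (n : ℝ) ^ s * 2 ^ (-D * ((2 * s : ℕ) : ℝ) ^ q) := by
        rw [← rpow_add (by norm_num)]
        gcongr
        · norm_num
        · have h3 := mul_le_mul_of_nonneg_left h2 hW0
          have h4 := mul_le_mul_of_nonneg_left h1 hD0
          rw [hW] at h3
          nlinarith
    _ = (n : ℝ) ^ s * δ ^ ((2 * s) ^ q) := by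
        rw [hδpow, ← rpow_natCast _ ((2 * s) ^ q), ← rpow_mul (by norm_num), Nat.cast_pow]

theorem ramseyTuran_le {W : Type*} {n : ℕ} {H : SimpleGraph W} {m c : ℝ} (hc : 0 ≤ c)
    (h : ∀ G : SimpleGraph (Fin n), H.Free G → (G.indepNum : ℝ) < m → (G.edgeSet.ncard : ℝ) ≤ c) :
    (ramseyTuran n H m : ℝ) ≤ c := by
  have h1 : ramseyTuran n H m ≤ ⌊c⌋₊ := by
    -- No nonemptiness is needed: in `ℕ` the supremum of the empty set is `0`.
    refine csSup_le' ?_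
    rintro _ ⟨G, hG, hind, rfl⟩
    exact Nat.le_floor (h G hG hind)
  exact (Nat.cast_le.2 h1).trans (Nat.floor_le hc)

open Finset in
theorem eventually_ramseyTuran_le (p q t : ℕ) (hq : 2 ≤ q) (ht : 2 ≤ t)
    (ω : ℕ → ℝ) (hω : Tendsto ω atTop atTop) (f : ℕ → ℝ)
    (hf : ∀ n : ℕ, f n =
      (n : ℝ) * (2 : ℝ) ^ (-(ω n * Real.logb 2 (n : ℝ) ^ (1 - 1 / (q : ℝ)))))
    (hpq : 2 * t ≤ p * q)
    (hQ : ∀ᶠ n : ℕ in atTop, ramseyQ t ⌊(n : ℝ) / ω n⌋₊ ≤ ramseyQ p ⌊f n⌋₊)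
    {ε : ℝ} (hε : 0 < ε) (hε1 : ε ≤ 1) :
    ∀ᶠ n : ℕ in atTop, (ramseyTuran n (SimpleGraph.completeGraph (Fin (2 * t)))
      (ramseyQ t ⌊(n : ℝ) / ω n⌋₊ : ℝ) : ℝ) ≤
        (1 / 2 * (1 - 1 / (t : ℝ)) * (1 - 1 / ((q : ℝ) - 1)) + 4 * ε) * (n : ℝ) ^ 2 := by
  classical
  have ht' : (2 : ℝ) ≤ t := by exact_mod_cast ht
  have hq' : (2 : ℝ) ≤ q := by exact_mod_cast hq
  have hτ : 0 ≤ 1 - 1 / (t : ℝ) := by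
    rw [sub_nonneg, div_le_one] <;> linarith
  have hσ : 0 ≤ 1 - 1 / ((q : ℝ) - 1) := by
    rw [sub_nonneg, div_le_one] <;> linarith
  obtain ⟨δ, hδ, hδ2, γ, hγ, N, hN⟩ := SimpleGraph.exists_card_edgeFinset_le hq hτ hε hε1
  obtain ⟨W, hW⟩ := eventually_pow_mul_pow_le p (by omega : 1 ≤ q) hδ (by linarith)
  -- `ω n ≥ W` serves the clique count; `ω n ≥ 2 / (ε * γ)` makes `n / ω n` small against sets of
  -- size `γ * n`.
  filter_upwards [hW, hQ, eventually_ge_atTop N, eventually_ge_atTop 1,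
    hω.eventually_ge_atTop W, hω.eventually_ge_atTop (2 / (ε * γ))]
    with n ⟨s, hs, hsm⟩ hQn hNn hn1 hωW hωγ
  have hn1' : (1 : ℝ) ≤ n := by exact_mod_cast hn1
  refine ramseyTuran_le (by positivity) fun G hG hind ↦ ?_
  have hind : G.indepNum < ramseyQ t ⌊(n : ℝ) / ω n⌋₊ := by exact_mod_cast hind
  have : Nonempty (Fin n) := ⟨⟨0, by omega⟩⟩
  have hfree : G.CliqueFree (2 * t) := by
    by_contra hcon
    exact hG ((SimpleGraph.not_cliqueFree_iff_top_isContained _).1 hcon)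
  have hω0 : 0 < ω n := lt_of_lt_of_le (by positivity) hωγ
  have hfew : (#{x : Fin q → Fin n | ∀ i j, i ≠ j → G.Adj (x i) (x j)} : ℝ) <
      δ * (n : ℝ) ^ q := by
    by_contra! hmany
    obtain ⟨K, hK, -⟩ := G.exists_isNClique_of_many_tuples (p := p) hs
      (m := (⌊f n⌋₊ : ℝ)) (by positivity)
      (fun A hA ↦ G.exists_isNClique_of_indepNum_lt_ramseyQ (hind.trans_le hQn) A
        (by exact_mod_cast hA)) q
      {x : Fin q → Fin n | ∀ i j, i ≠ j → G.Adj (x i) (x j)} δ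
      (fun x hx i j hij ↦ (mem_filter.1 hx).2 i j hij) hδ hδ2 (by simpa using hmany)
      (by
        rw [Fintype.card_fin]
        refine hsm _ (by positivity) ?_
        have h1 : 0 ≤ f n := by rw [hf]; positivity
        refine (Nat.floor_le h1).trans ?_
        rw [hf]
        have h2 : 0 ≤ Real.logb 2 (n : ℝ) ^ (1 - 1 / (q : ℝ)) :=
          Real.rpow_nonneg (Real.logb_nonneg (by norm_num) hn1') _
        gcongr
        norm_num)
    exact hfree.mono hpq K hK
  have hsmall : (n : ℝ) / ω n ≤ ε / 2 * (γ * n) := by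
    rw [div_le_iff₀ hω0]
    rw [div_le_iff₀ (by positivity)] at hωγ
    nlinarith
  have hdens : ∀ A B : Finset (Fin n), γ * n ≤ #A → γ * n ≤ #B →
      (#(G.interedges A B) : ℝ) ≤ (1 - 1 / (t : ℝ) + ε) * (#A * #B) := by
    intro A B hA hB
    by_contra! hlt
    obtain ⟨K, hK⟩ := G.exists_isNClique_two_mul (by omega : 1 ≤ t) hε
      (m := (n : ℝ) / ω n)
      (fun A hA ↦ G.exists_isNClique_of_indepNum_lt_ramseyQ hind A
        (Nat.floor_le_of_le hA)) A B
      (hsmall.trans (by gcongr)) (hsmall.trans (by gcongr)) hlt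
    rw [← two_mul] at hK
    exact hfree K hK
  have hmain := hN n hNn G hfew hdens
  have hcard : G.edgeSet.ncard = #G.edgeFinset := by
    rw [← SimpleGraph.coe_edgeFinset, Set.ncard_coe_finset]
  rw [hcard]
  linarith

theorem mainTheorem5 (p q t : ℕ) (hp : 2 ≤ p) (hq : 2 ≤ q) (ht : 2 ≤ t)
    (ω : ℕ → ℝ) (hω : Tendsto ω atTop atTop)
    (f : ℕ → ℝ)
    (hf : ∀ n : ℕ, f n =
      (n : ℝ) * (2 : ℝ) ^ (-(ω n * Real.logb 2 (n : ℝ) ^ (1 - 1 / (q : ℝ)))))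
    (hpq : 2 * t ≤ p * q)
    (hQ : ∀ᶠ n : ℕ in atTop, ramseyQ t ⌊(n : ℝ) / ω n⌋₊ ≤ ramseyQ p ⌊f n⌋₊) :
    upperRamseyTuranDensity (SimpleGraph.completeGraph (Fin (2 * t)))
        (fun n : ℕ => (ramseyQ t ⌊(n : ℝ) / ω n⌋₊ : ℝ))
      ≤ 1 / 2 * (1 - 1 / (t : ℝ)) * (1 - 1 / ((q : ℝ) - 1)) := by
  refine le_of_forall_pos_le_add fun ε hε ↦ ?_
  have h := eventually_ramseyTuran_le p q t hq ht ω hω f hf hpq hQ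
    (ε := min 1 (ε / 4)) (by positivity) (min_le_left _ _)
  -- Nonnegativity of the sequence supplies the coboundedness that a real `limsup` needs.
  refine limsup_le_of_le (isCoboundedUnder_le_of_le atTop (x := 0) fun _ ↦ by positivity) ?_
  filter_upwards [h, eventually_ge_atTop 1] with n hn hn1
  have hn1' : (1 : ℝ) ≤ n := by exact_mod_cast hn1
  rw [div_le_iff₀ (by positivity)]
  refine hn.trans ?_
  gcongr
  linarith [min_le_right 1 (ε / 4)]
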